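/- **Setting.** For $n\in\mathbb N$ let $V_n=[-n,n]\times[0,n]$ be the induced subgraph of the nearest-neighbour graph $\mathbb Z^2$. Each edge $e$ of $V_n$ carries a passage time $f(e)\in\{1,2\}$; the passage times are independent, equal to $1$ with probability $p$ and to $2$ with probability $1-p$, where $0<p<1$ is fixed. At time $0$ there is water exactly at the vertices of $V_n$ on the $x$-axis, and every edge from such a vertex is active, with that vertex as its source and with time component $f(e)$. There is no weight constraint ($M=\infty$). In each unit of time, the time component of every active edge decreases by $1$, and if it becomes $0$, then the water reaches the destination of that edge. A vertex that receives water for the first time becomes the source of all edges to neighbours that have no water yet; these edges become active with time component $f(e)$. An edge stops being active once there is water at its destination. A vertex is active at time $t\in\mathbb N$ if it is the source of an active edge at that time, and $A_t$ denotes the number of active vertices of $V_n$ at time $t$. **Theorem.** For every $p\in(0,1)$ there exist $t_0\ge 0$, $\mu>0$ and $\alpha>0$ such that for every integer $t>t_0$ there exists $n\le t$ for which the number $A_t$ of active vertices at time $t$ in the graph $V_n$ satisfies $$\mathbb P\left(A_t\ge \alpha\, t\log t\right)\ge e^{-\mu t^2}.$$ -/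

import Mathlib

open MeasureTheory

namespace WaterFlow

section Algorithm

variable {V : Type*} [Fintype V] [DecidableEq V] (G : SimpleGraph V) [DecidableRel G.Adj]

/-- A state of the label correcting algorithm in the unconstrained case `M = ∞`.

Initially the sources have label `∞` and the other vertices have label `0`, and `∞ - f₂(e) = ∞`.
So the labels are always `∞` (water of quality `∞` has reached the vertex) or `0`; `wet` is the set
of vertices with label `∞`.  No label of a wet vertex can be improved, so phantom edges never occur.

Each edge is stored once in each direction.  `flow d = some r` means that the edge is active with
source `d.fst` and destination `d.snd`, and that its remaining time component is `r`;
`flow d = none` means that no water flows through the edge from `d.fst` to `d.snd`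
(it is passive or used). -/
@[ext]
structure State where
  wet : Finset V
  flow : G.Dart → Option ℕ

variable {G}

/-- The original passage time of the edge underlying a dart. -/
def dartTime (f : G.edgeSet → ℕ) (d : G.Dart) : ℕ := f ⟨d.edge, d.edge_mem⟩

/-- At time `0` the water is in the vertices of `A`, and all edges from `A` are active. -/
def initial (f : G.edgeSet → ℕ) (A : Finset V) : State G where
  wet := A
  flow d := if d.fst ∈ A then some (dartTime f d) else none

/-- The vertices triggered in the next cycle: the destinations of the active edges whose time
component drops from `1` to `0`. -/
def triggered (s : State G) : Finset V :=
  Finset.univ.filter fun v => ∃ d : G.Dart, d.snd = v ∧ s.flow d = some 1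

/-- The vertices with water after the next cycle. -/
def nextWet (s : State G) : Finset V := s.wet ∪ triggered s

/-- One cycle (one unit of time).
* An edge whose destination has water after the cycle carries no flow any more: either it has
  become used, or its water can no longer improve the label of its destination.
* An edge from a vertex that has just received its first water to a vertex without water becomes
  active, with its original passage time as its time component.
* The time component of every other active edge decreases by `1`. -/
def cycle (f : G.edgeSet → ℕ) (s : State G) : State G where
  wet := nextWet s
  flow d :=
    if d.snd ∈ nextWet s then none
    else if d.fst ∈ nextWet s \ s.wet then some (dartTime f d)
    else (s.flow d).map fun r => r - 1

/-- The state at time `t`. -/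
def stateAt (f : G.edgeSet → ℕ) (A : Finset V) (t : ℕ) : State G := (cycle f)^[t] (initial f A)

/-- A vertex is active at time `t` if it is the source of an active edge. -/
def activeVertices (f : G.edgeSet → ℕ) (A : Finset V) (t : ℕ) : Finset V :=
  Finset.univ.filter fun v => ∃ d : G.Dart, d.fst = v ∧ ((stateAt f A t).flow d).isSome

end Algorithm

/-- The vertex set `[-n, n] × [0, n]` in `ℤ²`. -/
abbrev Box (n : ℕ) : Type :=
  {v : ℤ × ℤ // v ∈ Finset.Icc (-(n : ℤ)) (n : ℤ) ×ˢ Finset.Icc (0 : ℤ) (n : ℤ)}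

/-- The subgraph of the nearest neighbour graph `ℤ²` induced on the box. -/
def boxGraph (n : ℕ) : SimpleGraph (Box n) where
  Adj u v := |u.1.1 - v.1.1| + |u.1.2 - v.1.2| = 1
  symm := ⟨fun u v h => by rw [abs_sub_comm v.1.1, abs_sub_comm v.1.2]; exact h⟩
  loopless := ⟨fun u h => by simp at h⟩

instance (n : ℕ) : DecidableRel (boxGraph n).Adj := fun u v =>
  inferInstanceAs (Decidable (|u.1.1 - v.1.1| + |u.1.2 - v.1.2| = 1))

/-- The vertices of the box on the `x` axis, where the water is at time `0`. -/
noncomputable def xAxis (n : ℕ) : Finset (Box n) := Finset.univ.filter fun v => v.1.2 = 0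

/-- The law of a passage time: `1` with probability `p` and `2` with probability `1 - p`. -/
noncomputable def passageLaw (p : ℝ) : Measure ℕ :=
  ENNReal.ofReal p • Measure.dirac 1 + ENNReal.ofReal (1 - p) • Measure.dirac 2

/-- The law of independent passage times, one for each edge of the box. -/
noncomputable def environmentLaw (p : ℝ) (n : ℕ) : Measure ((boxGraph n).edgeSet → ℕ) :=
  Measure.pi fun _ => passageLaw p

/-- The number of active vertices at time `t` in the box. -/
noncomputable def numActive (n t : ℕ) (ω : (boxGraph n).edgeSet → ℕ) : ℕ :=
  (activeVertices ω (xAxis n) t).card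

end WaterFlow

namespace WaterFlow

/-! ### Upper and lower bounds for arrival times in the algorithm -/

section Algorithm

variable {V : Type*} [Fintype V] [DecidableEq V] {G : SimpleGraph V} [DecidableRel G.Adj]

/-! It suffices to find one environment on `V_t` with at least a constant times `t log t` active
vertices: `V_t` has `O(t²)` edges, so a single environment has probability at least `e^{-μt²}`.

The environment is read off from a prescribed profile `arrival`, equal to `min (2y) (x + y)` apart
from delays in square pockets. For each scale `s = 17 ^ k`, pockets of side `16 s` line up along an
antidiagonal just below `x + y = t`. The delay rises with slope `1` and falls with slope `3`, so
`arrival` changes by at most `2` along each edge and is a lower bound for the true arrival times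
(`arrival_le_of_mem_wet`). Undelayed vertices are reached by time `x + y` along paths avoiding the
pockets (`vertex_mem_wet_add`).

At time `t`, each of `s` rows of a pocket thus runs from a wet vertex on its left side to a dry one
inside, and contains an active vertex (`exists_active`). There are about `t / (64 s)` usable pockets
of scale `s`, hence about `t / 64` active vertices per scale, and of order `log t` scales in
disjoint bands (`mul_le_numActive`). -/

theorem stateAt_succ (f : G.edgeSet → ℕ) (A : Finset V) (t : ℕ) :
    stateAt f A (t + 1) = cycle f (stateAt f A t) :=
  Function.iterate_succ_apply' ..

theorem stateAt_zero_wet (f : G.edgeSet → ℕ) (A : Finset V) : (stateAt f A 0).wet = A := rfl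

theorem wet_mono (f : G.edgeSet → ℕ) (A : Finset V) {s t : ℕ} (h : s ≤ t) :
    (stateAt f A s).wet ⊆ (stateAt f A t).wet := by
  induction t, h using Nat.le_induction with
  | base => exact subset_rfl
  | succ t _ ih =>
    rw [stateAt_succ]
    exact ih.trans Finset.subset_union_left

/-- A vertex with water either has passed it on to a given neighbour, or is the source of an active
edge to that neighbour. -/
theorem snd_mem_wet_or_flow (f : G.edgeSet → ℕ) (hf : ∀ e, 1 ≤ f e) (A : Finset V) (t : ℕ)
    (d : G.Dart) (hd : d.fst ∈ (stateAt f A t).wet) :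
    d.snd ∈ (stateAt f A t).wet ∨
      ∃ r, (stateAt f A t).flow d = some r ∧ 1 ≤ r ∧ r ≤ dartTime f d := by
  induction t with
  | zero =>
    right
    have hd' : d.fst ∈ A := hd
    exact ⟨dartTime f d, by simp [stateAt, initial, hd'], hf _, le_rfl⟩
  | succ t ih =>
    rw [stateAt_succ] at hd ⊢
    set s := stateAt f A t
    by_cases hsnd : d.snd ∈ nextWet s
    · exact Or.inl hsnd
    right
    by_cases hfst : d.fst ∈ s.wet
    · rcases ih hfst with h | ⟨r, hr, h1, hle⟩
      · exact absurd (Finset.mem_union_left _ h) hsnd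
      · have hr1 : r ≠ 1 := by
          rintro rfl
          exact hsnd (Finset.mem_union_right _
            (Finset.mem_filter.2 ⟨Finset.mem_univ _, d, rfl, hr⟩))
        refine ⟨r - 1, ?_, by omega, by omega⟩
        simp [cycle, hsnd, hfst, hr]
    · refine ⟨dartTime f d, ?_, hf _, le_rfl⟩
      have hnew : d.fst ∈ nextWet s := hd
      simp [cycle, hsnd, hfst, hnew]

/-- Water passes an edge within its passage time. -/
theorem snd_mem_wet_add (f : G.edgeSet → ℕ) (hf : ∀ e, 1 ≤ f e) (A : Finset V) (t : ℕ)
    (d : G.Dart) (hd : d.fst ∈ (stateAt f A t).wet) :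
    d.snd ∈ (stateAt f A (t + dartTime f d)).wet := by
  have key : ∀ r t, d.fst ∈ (stateAt f A t).wet → (stateAt f A t).flow d = some r → 1 ≤ r →
      d.snd ∈ (stateAt f A (t + r)).wet := by
    intro r
    induction r with
    | zero => intro t _ _ h; omega
    | succ r ih =>
      intro t hfst hflow _
      rcases Nat.eq_zero_or_pos r with rfl | hr
      · rw [stateAt_succ]
        exact Finset.mem_union_right _
          (Finset.mem_filter.2 ⟨Finset.mem_univ _, d, rfl, hflow⟩)
      · by_cases hsnd : d.snd ∈ nextWet (stateAt f A t)
        · have h : d.snd ∈ (stateAt f A (t + 1)).wet := by rw [stateAt_succ]; exact hsnd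
          exact wet_mono f A (by omega) h
        · have h := ih (t + 1) (wet_mono f A (Nat.le_succ t) hfst)
            (by rw [stateAt_succ]; simp [cycle, hsnd, hfst, hflow]) hr
          rwa [show t + (r + 1) = t + 1 + r by omega]
  rcases snd_mem_wet_or_flow f hf A t d hd with h | ⟨r, hr, h1, hle⟩
  · exact wet_mono f A (by omega) h
  · exact wet_mono f A (by omega) (key r t hd hr h1)

/-- A function that vanishes at the sources and grows along each edge by at most its passage time
is a lower bound for the arrival times. -/
theorem le_of_mem_wet (f : G.edgeSet → ℕ) (A : Finset V) (g : V → ℕ) (hA : ∀ v ∈ A, g v = 0)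
    (hg : ∀ d : G.Dart, g d.snd ≤ g d.fst + dartTime f d) (t : ℕ) {v : V}
    (hv : v ∈ (stateAt f A t).wet) : g v ≤ t := by
  -- The induction must also track water in transit: `t + r` is the time at which an active edge
  -- delivers.
  suffices h : (∀ v ∈ (stateAt f A t).wet, g v ≤ t) ∧
      ∀ d r, (stateAt f A t).flow d = some r → g d.fst + dartTime f d ≤ t + r from h.1 v hv
  clear hv v
  induction t with
  | zero =>
    refine ⟨fun v hv => (hA v hv).le, fun d r hr => ?_⟩
    simp only [stateAt, initial, Function.iterate_zero, id] at hr
    split_ifs at hr with h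
    have := hA _ h
    simp only [Option.some.injEq] at hr
    omega
  | succ t ih =>
    rw [stateAt_succ]
    set s := stateAt f A t
    have hwet : ∀ v ∈ nextWet s, g v ≤ t + 1 := by
      intro v hv
      rcases Finset.mem_union.1 hv with h | h
      · exact (ih.1 v h).trans (Nat.le_succ t)
      · obtain ⟨-, d, rfl, hd⟩ := Finset.mem_filter.1 h
        exact (hg d).trans (ih.2 d 1 hd)
    refine ⟨hwet, fun d r hr => ?_⟩
    simp only [cycle] at hr
    split_ifs at hr with h1 h2
    · have := hwet _ (Finset.mem_sdiff.1 h2).1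
      simp only [Option.some.injEq] at hr
      omega
    · obtain ⟨q, hq, rfl⟩ := Option.map_eq_some_iff.1 hr
      have := ih.2 d q hq
      omega

theorem fst_mem_activeVertices (f : G.edgeSet → ℕ) (hf : ∀ e, 1 ≤ f e) (A : Finset V) (t : ℕ)
    (d : G.Dart) (hfst : d.fst ∈ (stateAt f A t).wet) (hsnd : d.snd ∉ (stateAt f A t).wet) :
    d.fst ∈ activeVertices f A t := by
  rcases snd_mem_wet_or_flow f hf A t d hfst with h | ⟨r, hr, -⟩
  · exact absurd h hsnd
  · exact Finset.mem_filter.2 ⟨Finset.mem_univ _, d, rfl, by simp [hr]⟩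

end Algorithm

/-! ### Passage times read off from a profile -/

section AdaptedTimes

variable {V : Type*} {G : SimpleGraph V}

open Classical in
/-- The passage times `1` and `2` that are adapted to a function on the vertices: an edge has passage
time `2` if the values at its endpoints differ by at least `2`. -/
noncomputable def adaptedTimes (g : V → ℕ) : G.edgeSet → ℕ := fun e =>
  if ∃ u v, e.1 = s(u, v) ∧ g u + 2 ≤ g v then 2 else 1

theorem adaptedTimes_eq_one_or_two (g : V → ℕ) (e : G.edgeSet) :
    adaptedTimes g e = 1 ∨ adaptedTimes g e = 2 := by
  unfold adaptedTimes
  split_ifs <;> simp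

theorem dartTime_adaptedTimes_le_two (g : V → ℕ) (d : G.Dart) :
    dartTime (adaptedTimes g) d ≤ 2 := by
  rcases adaptedTimes_eq_one_or_two g ⟨d.edge, d.edge_mem⟩ with h | h <;> simp [dartTime, h]

theorem le_add_dartTime_adaptedTimes (g : V → ℕ) (d : G.Dart) (h : g d.snd ≤ g d.fst + 2) :
    g d.snd ≤ g d.fst + dartTime (adaptedTimes g) d := by
  unfold dartTime adaptedTimes
  split_ifs with hd
  · exact h
  · by_contra hlt
    exact hd ⟨d.fst, d.snd, rfl, by omega⟩

theorem dartTime_adaptedTimes_of_le (g : V → ℕ) (d : G.Dart) (h : g d.snd ≤ g d.fst + 1)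
    (h' : g d.fst ≤ g d.snd + 1) : dartTime (adaptedTimes g) d = 1 := by
  unfold dartTime adaptedTimes
  rw [if_neg]
  rintro ⟨u, v, huv, hle⟩
  have huv' : s(d.fst, d.snd) = s(u, v) := huv
  rcases Sym2.eq_iff.1 huv' with ⟨rfl, rfl⟩ | ⟨rfl, rfl⟩ <;> omega

end AdaptedTimes

/-! ### The profile with delay pockets at all scales -/

section Profile

/-- A pyramid over the square `[0, m]²`, with slope `1` on the two lower sides and slope `-3` on the
two upper sides, at the point `(i, z - i)`. -/
def pyramid (m i z : ℕ) : ℕ := min (min i (z - i)) (min (3 * (m - i)) (3 * (m + i - z)))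

/-- Pyramids over the squares of side `16 s` with lower left corners
`(16 s a, t - 34 s - 16 s a)`. -/
def bump (t s x y : ℕ) : ℕ := pyramid (16 * s) (x % (16 * s)) (x + y - (t - 34 * s))

/-- The delay at `(x, y)` caused by the pockets of the scales `17 ^ k`, `k < K`. -/
def delay (t K x y : ℕ) : ℕ := (Finset.range K).sup fun k => bump t (17 ^ k) x y

/-- The arrival time at `(x, y)`. -/
def arrival (t K x y : ℕ) : ℕ := min (2 * y) (x + y + delay t K x y)

theorem pyramid_pos_iff {m i z : ℕ} :
    0 < pyramid m i z ↔ 0 < i ∧ i < z ∧ i < m ∧ z < m + i := by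
  simp only [pyramid, lt_min_iff]
  omega

theorem pyramid_eq_zero {m i z : ℕ} (h : i = 0 ∨ z ≤ i ∨ m ≤ i ∨ m + i ≤ z) :
    pyramid m i z = 0 := by
  by_contra hne
  have := pyramid_pos_iff.1 (Nat.pos_of_ne_zero hne)
  omega

theorem min_le_min_add {a b a' b' c : ℕ} (h : a ≤ a' + c) (h' : b ≤ b' + c) :
    min a b ≤ min a' b' + c := by
  omega

/-- This is a step to the right, which fixes `z - i`; `pyramid_succ` is a step up. -/
theorem pyramid_succ_succ (m i z : ℕ) :
    pyramid m (i + 1) (z + 1) ≤ pyramid m i z + 1 ∧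
      pyramid m i z ≤ pyramid m (i + 1) (z + 1) + 3 := by
  constructor <;> refine min_le_min_add (min_le_min_add ?_ ?_) (min_le_min_add ?_ ?_) <;> omega

theorem pyramid_succ (m i z : ℕ) :
    pyramid m i (z + 1) ≤ pyramid m i z + 1 ∧ pyramid m i z ≤ pyramid m i (z + 1) + 3 := by
  constructor <;> refine min_le_min_add (min_le_min_add ?_ ?_) (min_le_min_add ?_ ?_) <;> omega

theorem succ_mod_cases (x : ℕ) {m : ℕ} (hm : 1 < m) :
    (x + 1) % m = x % m + 1 ∨ (x % m + 1 = m ∧ (x + 1) % m = 0) := by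
  have := Nat.mod_lt x (show 0 < m by omega)
  rw [Nat.add_mod_eq_ite, Nat.mod_eq_of_lt hm]
  split_ifs <;> omega

theorem bump_succ_left (t s x y : ℕ) (hs : 0 < s) :
    bump t s (x + 1) y ≤ bump t s x y + 1 ∧ bump t s x y ≤ bump t s (x + 1) y + 3 := by
  unfold bump
  rcases Nat.lt_or_ge (x + y) (t - 34 * s) with h | h
  · rw [pyramid_eq_zero (z := x + y - _) (by omega), pyramid_eq_zero (by omega)]
    omega
  rw [show x + 1 + y - (t - 34 * s) = x + y - (t - 34 * s) + 1 by omega]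
  rcases succ_mod_cases x (show 1 < 16 * s by omega) with hx | ⟨hx, hx'⟩
  · rw [hx]
    exact pyramid_succ_succ ..
  -- The step crosses into the next square. In the last column `m - i = 1`, so the side of slope
  -- `-3` bounds the pyramid by `3`.
  · rw [hx', pyramid_eq_zero (i := 0) (by omega)]
    refine ⟨Nat.zero_le _, (min_le_right _ _).trans ((min_le_left _ _).trans ?_)⟩
    omega

theorem bump_succ_right (t s x y : ℕ) :
    bump t s x (y + 1) ≤ bump t s x y + 1 ∧ bump t s x y ≤ bump t s x (y + 1) + 3 := by
  unfold bump
  rcases Nat.lt_or_ge (x + y) (t - 34 * s) with h | h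
  · rw [pyramid_eq_zero (z := x + y - _) (by omega), pyramid_eq_zero (by omega)]
    omega
  rw [show x + (y + 1) - (t - 34 * s) = x + y - (t - 34 * s) + 1 by omega]
  exact pyramid_succ ..

theorem bump_le_delay (t : ℕ) {k K : ℕ} (hk : k < K) (x y : ℕ) :
    bump t (17 ^ k) x y ≤ delay t K x y :=
  Finset.le_sup (f := fun k => bump t (17 ^ k) x y) (Finset.mem_range.2 hk)

theorem delay_le_delay_add {t K x y x' y' c : ℕ}
    (h : ∀ s, 0 < s → bump t s x y ≤ bump t s x' y' + c) :
    delay t K x y ≤ delay t K x' y' + c := by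
  refine Finset.sup_le fun k hk => (h _ (by positivity)).trans (Nat.add_le_add_right ?_ c)
  exact bump_le_delay t (Finset.mem_range.1 hk) x' y'

/-- The sum `x + y` grows by `1` and the delay changes by between `-3` and `1`, so their total
changes by at most `2` in absolute value. This is why the slopes are `1` and `-3`. -/
theorem arrival_succ_left (t K x y : ℕ) :
    arrival t K (x + 1) y ≤ arrival t K x y + 2 ∧ arrival t K x y ≤ arrival t K (x + 1) y + 2 := by
  have h := delay_le_delay_add (K := K) fun s hs => (bump_succ_left t s x y hs).1
  have h' := delay_le_delay_add (K := K) fun s hs => (bump_succ_left t s x y hs).2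
  unfold arrival
  omega

theorem arrival_succ_right (t K x y : ℕ) :
    arrival t K x (y + 1) ≤ arrival t K x y + 2 ∧ arrival t K x y ≤ arrival t K x (y + 1) + 2 := by
  have h := delay_le_delay_add (K := K) fun s _ => (bump_succ_right t s x y).1
  have h' := delay_le_delay_add (K := K) fun s _ => (bump_succ_right t s x y).2
  unfold arrival
  omega

theorem delay_eq_zero_iff {t K x y : ℕ} :
    delay t K x y = 0 ↔ ∀ k < K, bump t (17 ^ k) x y = 0 := by
  refine ⟨fun h k hk => Nat.le_zero.1 (h ▸ bump_le_delay t hk x y), fun h => Nat.le_zero.1 ?_⟩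
  exact Finset.sup_le fun k hk => (h k (Finset.mem_range.1 hk)).le

/-- The pockets of different scales lie in disjoint diagonal bands. -/
theorem scale_unique {t k l w : ℕ} (hk : 34 * 17 ^ k ≤ t) (hl : 34 * 17 ^ l ≤ t)
    (hk1 : t - 34 * 17 ^ k < w) (hk2 : w < t - 2 * 17 ^ k)
    (hl1 : t - 34 * 17 ^ l < w) (hl2 : w < t - 2 * 17 ^ l) : k = l := by
  have key : ∀ {k l : ℕ}, k < l → 17 * 17 ^ k ≤ 17 ^ l := fun {k l} h => by
    rw [← pow_succ']
    exact Nat.pow_le_pow_right (by norm_num) h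
  -- For `k < l`, the band of `l` ends at `t - 2 * 17 ^ l ≤ t - 34 * 17 ^ k`, where that of `k`
  -- begins.
  rcases lt_trichotomy k l with h | h | h
  · have := key h
    omega
  · exact h
  · have := key h
    omega

theorem band_of_bump_pos {t s x y : ℕ} (hs : 0 < s) (hst : 34 * s ≤ t) (h : 0 < bump t s x y) :
    t - 34 * s < x + y ∧ x + y < t - 2 * s := by
  have := pyramid_pos_iff.1 h
  have := Nat.mod_lt x (show 0 < 16 * s by omega)
  omega

theorem delay_eq_zero_of_band {t K x y k : ℕ} (hK : ∀ l < K, 34 * 17 ^ l ≤ t) (hk : k < K)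
    (h1 : t - 34 * 17 ^ k < x + y) (h2 : x + y < t - 2 * 17 ^ k)
    (h0 : bump t (17 ^ k) x y = 0) : delay t K x y = 0 := by
  rw [delay_eq_zero_iff]
  intro l hl
  by_contra hne
  obtain ⟨h3, h4⟩ := band_of_bump_pos (by positivity) (hK l hl) (Nat.pos_of_ne_zero hne)
  obtain rfl := scale_unique (hK k hk) (hK l hl) h1 h2 h3 h4
  exact hne h0

/-- From a point without delay one can go down or left to a point without delay. -/
theorem exists_delay_eq_zero {t K x y : ℕ} (hK : ∀ k < K, 34 * 17 ^ k ≤ t)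
    (h : delay t K x (y + 1) = 0) :
    delay t K x y = 0 ∨ ∃ x', x = x' + 1 ∧ delay t K x' (y + 1) = 0 := by
  by_cases h0 : delay t K x y = 0
  · exact Or.inl h0
  right
  rw [delay_eq_zero_iff] at h0
  push Not at h0
  obtain ⟨k, hk, hb⟩ := h0
  have hb' := delay_eq_zero_iff.1 h k hk
  have hs : 0 < 17 ^ k := by positivity
  obtain ⟨h1, h2⟩ := band_of_bump_pos hs (hK k hk) (Nat.pos_of_ne_zero hb)
  have hpos := pyramid_pos_iff.1 (Nat.pos_of_ne_zero hb)
  -- So `(x, y + 1)` lies on the top side of a pocket, and its left neighbour is still on that side,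
  -- possibly at the corner.
  have htop : ¬ 0 < bump t (17 ^ k) x (y + 1) := by omega
  rw [bump, pyramid_pos_iff] at htop
  cases x with
  | zero => simp at hpos
  | succ x =>
    refine ⟨x, rfl, delay_eq_zero_of_band hK hk (by omega) (by omega) (pyramid_eq_zero ?_)⟩
    have := succ_mod_cases x (show 1 < 16 * 17 ^ k by omega)
    omega

end Profile

/-! ### The environment and its active vertices -/

section Environment

/-- The passage times that realize `arrival`, symmetrically in the vertical axis. -/
noncomputable def environment (t K : ℕ) : (boxGraph t).edgeSet → ℕ :=
  adaptedTimes fun v => arrival t K v.1.1.natAbs v.1.2.toNat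

theorem one_le_environment (t K : ℕ) (e : (boxGraph t).edgeSet) : 1 ≤ environment t K e := by
  rcases adaptedTimes_eq_one_or_two (fun v => arrival t K v.1.1.natAbs v.1.2.toNat) e with h | h <;>
    rw [environment, h]
  norm_num

theorem arrival_snd_le (t K : ℕ) (d : (boxGraph t).Dart) :
    arrival t K d.snd.1.1.natAbs d.snd.1.2.toNat ≤
      arrival t K d.fst.1.1.natAbs d.fst.1.2.toNat + 2 := by
  have hadj : |d.fst.1.1 - d.snd.1.1| + |d.fst.1.2 - d.snd.1.2| = 1 := d.adj
  have hu := Finset.mem_product.1 d.fst.2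
  have hv := Finset.mem_product.1 d.snd.2
  rw [Finset.mem_Icc, Finset.mem_Icc] at hu hv
  generalize d.fst.1 = u at *
  generalize d.snd.1 = v at *
  -- Folding along the vertical axis maps edges to edges.
  have h : (u.1.natAbs = v.1.natAbs ∧ u.2.toNat = v.2.toNat + 1) ∨
      (u.1.natAbs = v.1.natAbs ∧ v.2.toNat = u.2.toNat + 1) ∨
      (u.1.natAbs = v.1.natAbs + 1 ∧ u.2.toNat = v.2.toNat) ∨
      (v.1.natAbs = u.1.natAbs + 1 ∧ u.2.toNat = v.2.toNat) := by
    rcases abs_cases (u.1 - v.1) with h1 | h1 <;> rcases abs_cases (u.2 - v.2) with h2 | h2 <;> omega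
  rcases h with ⟨h1, h2⟩ | ⟨h1, h2⟩ | ⟨h1, h2⟩ | ⟨h1, h2⟩ <;> rw [h1, h2]
  · exact (arrival_succ_right ..).2
  · exact (arrival_succ_right ..).1
  · exact (arrival_succ_left ..).2
  · exact (arrival_succ_left ..).1

/-- The vertex `(x, y)` of the box. -/
def vertex {n x y : ℕ} (hx : x ≤ n) (hy : y ≤ n) : Box n :=
  ⟨((x : ℤ), (y : ℤ)), by
    rw [Finset.mem_product, Finset.mem_Icc, Finset.mem_Icc]
    dsimp only
    omega⟩

theorem adj_vertex_right {n x y : ℕ} (hx : x + 1 ≤ n) (hy : y ≤ n) :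
    (boxGraph n).Adj (vertex (Nat.le_of_succ_le hx) hy) (vertex hx hy) := by
  simp [boxGraph, vertex]

theorem adj_vertex_up {n x y : ℕ} (hx : x ≤ n) (hy : y + 1 ≤ n) :
    (boxGraph n).Adj (vertex hx (Nat.le_of_succ_le hy)) (vertex hx hy) := by
  simp [boxGraph, vertex]

theorem arrival_le_of_mem_wet {t K τ x y : ℕ} (hx : x ≤ t) (hy : y ≤ t)
    (h : vertex hx hy ∈ (stateAt (environment t K) (xAxis t) τ).wet) : arrival t K x y ≤ τ := by
  let g : Box t → ℕ := fun v => arrival t K v.1.1.natAbs v.1.2.toNat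
  refine le_of_mem_wet _ _ g (fun v hv => ?_)
    (fun d => le_add_dartTime_adaptedTimes g d (arrival_snd_le t K d)) τ h
  have : v.1.2 = 0 := (Finset.mem_filter.1 hv).2
  simp [g, this, arrival]

theorem vertex_mem_wet_two_mul (t K x y : ℕ) (hx : x ≤ t) (hy : y ≤ t) :
    vertex hx hy ∈ (stateAt (environment t K) (xAxis t) (2 * y)).wet := by
  induction y with
  | zero =>
    rw [Nat.mul_zero, stateAt_zero_wet]
    simp [xAxis, vertex]
  | succ y ih =>
    have h := snd_mem_wet_add _ (one_le_environment t K) _ _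
      ⟨(_, _), adj_vertex_up hx hy⟩ (ih (Nat.le_of_succ_le hy))
    refine wet_mono _ _ ?_ h
    rw [Nat.mul_succ]
    exact Nat.add_le_add_left (dartTime_adaptedTimes_le_two ..) _

/-- Where there is no delay, the water arrives at `(x, y)` by time `x + y`. -/
theorem vertex_mem_wet_add {t K : ℕ} (hK : ∀ k < K, 34 * 17 ^ k ≤ t) (N : ℕ) :
    ∀ {x y : ℕ} (hx : x ≤ t) (hy : y ≤ t), delay t K x y = 0 → x + y = N →
      vertex hx hy ∈ (stateAt (environment t K) (xAxis t) N).wet := by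
  induction N with
  | zero =>
    intro x y hx hy _ h
    exact wet_mono _ _ (by omega) (vertex_mem_wet_two_mul t K x y hx hy)
  | succ N ih =>
    intro x y hx hy h0 hN
    by_cases hxy : y ≤ x
    -- Here `2 * y ≤ x + y`, so going straight up is fast enough.
    · exact wet_mono _ _ (by omega) (vertex_mem_wet_two_mul t K x y hx hy)
    have step : ∀ u : Box t, u ∈ (stateAt (environment t K) (xAxis t) N).wet →
        (boxGraph t).Adj u (vertex hx hy) → arrival t K u.1.1.natAbs u.1.2.toNat = N →
        vertex hx hy ∈ (stateAt (environment t K) (xAxis t) (N + 1)).wet := by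
      intro u hu hadj hval
      have h := snd_mem_wet_add _ (one_le_environment t K) _ _ ⟨(_, _), hadj⟩ hu
      have hv : arrival t K x y = N + 1 := by
        unfold arrival
        omega
      -- The profile grows by exactly `1` along this edge, so its passage time is `1`.
      rwa [environment, dartTime_adaptedTimes_of_le] at h
      · exact le_of_eq (by simpa [vertex, hval] using hv)
      · refine hval.le.trans ?_
        simp only [Int.natAbs_natCast, Int.toNat_natCast, hv]
        omega
    cases y with
    | zero => omega
    | succ y =>
      rcases exists_delay_eq_zero hK h0 with h | ⟨x', rfl, h⟩
      · refine step _ (ih hx (Nat.le_of_succ_le hy) h (by omega)) (adj_vertex_up hx hy) ?_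
        simp only [vertex, Int.natAbs_natCast, Int.toNat_natCast, arrival]
        omega
      · refine step _ (ih (Nat.le_of_succ_le hx) hy h (by omega)) (adj_vertex_right hx hy) ?_
        simp only [vertex, Int.natAbs_natCast, Int.toNat_natCast, arrival]
        omega

/-- Each of the `17 ^ k` rows through the centre of a pocket contains an active vertex. -/
theorem exists_active {t K k a d : ℕ} (hK : ∀ l < K, 136 * 17 ^ l ≤ t) (hk : k < K)
    (ha : 64 * a * 17 ^ k < t) (hd : d < 17 ^ k) :
    ∃ x, 16 * 17 ^ k * a ≤ x ∧ x < 16 * 17 ^ k * a + 12 * 17 ^ k ∧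
      ∃ v ∈ activeVertices (environment t K) (xAxis t) t,
        v.1 = ((x : ℤ), (t : ℤ) - 22 * 17 ^ k - 16 * 17 ^ k * a - d) := by
  have hK' : ∀ l < K, 34 * 17 ^ l ≤ t := fun l hl => le_trans (by omega) (hK l hl)
  have hs := hK k hk
  set X := 16 * 17 ^ k * a with hX
  have hXt : 4 * X < t := by
    rw [hX]
    calc _ = 64 * a * 17 ^ k := by ring
      _ < t := ha
  have hbump0 : ∀ y, bump t (17 ^ k) X y = 0 := by
    intro y
    simp [bump, pyramid, hX]
  have hmod : (X + 12 * 17 ^ k) % (16 * 17 ^ k) = 12 * 17 ^ k := by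
    rw [hX, Nat.mul_add_mod, Nat.mod_eq_of_lt (by omega)]
  obtain ⟨y, hy⟩ : ∃ y, y + 22 * 17 ^ k + X + d = t := ⟨t - 22 * 17 ^ k - X - d, by omega⟩
  have hyt : y ≤ t := by omega
  have hstart : vertex (show X ≤ t by omega) hyt ∈
      (stateAt (environment t K) (xAxis t) t).wet := by
    refine wet_mono _ _ (by omega) (vertex_mem_wet_add hK' (X + y) _ hyt ?_ rfl)
    exact delay_eq_zero_of_band hK' hk (by omega) (by omega) (hbump0 y)
  have hend : vertex (show X + 12 * 17 ^ k ≤ t by omega) hyt ∉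
      (stateAt (environment t K) (xAxis t) t).wet := by
    intro h
    have h1 := arrival_le_of_mem_wet _ _ h
    have h2 := bump_le_delay t hk (X + 12 * 17 ^ k) y
    -- With `s = 17 ^ k`, here `x + y = t - 10 s - d`, so the delayed time is at least `t + 2 s - 2
    -- d > t`. Also `2 * y > t`, since `4 * X < t` and `136 * s ≤ t`.
    have h3 : 12 * 17 ^ k - d ≤ bump t (17 ^ k) (X + 12 * 17 ^ k) y := by
      rw [bump, hmod]
      refine le_min (le_min ?_ ?_) (le_min ?_ ?_) <;> omega
    unfold arrival at h1
    omega
  obtain ⟨j, hj, hwet, hdry⟩ : ∃ j, ∃ hj : j < 12 * 17 ^ k,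
      vertex (show X + j ≤ t by omega) hyt ∈ (stateAt (environment t K) (xAxis t) t).wet ∧
      vertex (show X + j + 1 ≤ t by omega) hyt ∉
        (stateAt (environment t K) (xAxis t) t).wet := by
    by_contra! hcon
    have : ∀ j (hj : j ≤ 12 * 17 ^ k), vertex (show X + j ≤ t by omega) hyt ∈
        (stateAt (environment t K) (xAxis t) t).wet := by
      intro j
      induction j with
      | zero => exact fun _ => hstart
      | succ j ih => exact fun hj => hcon j hj (ih (by omega))
    exact hend (this _ le_rfl)
  refine ⟨X + j, by omega, by omega, _, fst_mem_activeVertices _ (one_le_environment t K) _ _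
    ⟨(_, _), adj_vertex_right (show X + j + 1 ≤ t by omega) hyt⟩ hwet hdry, ?_⟩
  refine Prod.ext rfl ?_
  change (y : ℤ) = _
  have hX' : (X : ℤ) = 16 * 17 ^ k * a := by rw [hX]; push_cast; ring
  have : (y : ℤ) + 22 * 17 ^ k + X + d = t := by exact_mod_cast hy
  rw [← hX']
  linarith

/-- The triples (scale, pocket, row) inject into the active vertices: the band of `x + y` determines
the scale, then `x` the pocket, then `y` the row. -/
theorem mul_le_numActive {t K : ℕ} (hK : ∀ l < K, 136 * 17 ^ l ≤ t) :
    K * t ≤ 64 * numActive t t (environment t K) := by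
  classical
  let N : ℕ → ℕ := fun k => (t - 1) / (64 * 17 ^ k) + 1
  let S : Finset (Σ _ : ℕ, ℕ × ℕ) :=
    (Finset.range K).sigma fun k => Finset.range (N k) ×ˢ Finset.range (17 ^ k)
  have hS : ∀ q ∈ S, q.1 < K ∧ 64 * q.2.1 * 17 ^ q.1 < t ∧ q.2.2 < 17 ^ q.1 := by
    rintro ⟨k, a, d⟩ hq
    simp only [S, Finset.mem_sigma, Finset.mem_product, Finset.mem_range, N] at hq
    obtain ⟨hk, ha, hd⟩ := hq
    refine ⟨hk, ?_, hd⟩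
    have hs : 0 < 17 ^ k := by positivity
    have := hK k hk
    have h := (Nat.le_div_iff_mul_le (by positivity)).1 (Nat.lt_succ_iff.1 ha)
    have h' : 64 * a * 17 ^ k = a * (64 * 17 ^ k) := by ring
    dsimp only
    omega
  have hcard : K * t ≤ 64 * S.card := by
    rw [Finset.card_sigma, Finset.mul_sum]
    calc K * t = ∑ _k ∈ Finset.range K, t := by simp
      _ ≤ _ := Finset.sum_le_sum fun k _ => by
        rw [Finset.card_product, Finset.card_range, Finset.card_range]
        have h := Nat.lt_mul_div_succ (t - 1) (show 0 < 64 * 17 ^ k by positivity)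
        have h' : 64 * (N k * 17 ^ k) = 64 * 17 ^ k * ((t - 1) / (64 * 17 ^ k) + 1) := by
          simp only [N]; ring
        omega
  refine hcard.trans (Nat.mul_le_mul_left _ ?_)
  have hex : ∀ q : (Σ _ : ℕ, ℕ × ℕ), ∃ v : Box t, q ∈ S →
      v ∈ activeVertices (environment t K) (xAxis t) t ∧
      ∃ x : ℕ, 16 * 17 ^ q.1 * q.2.1 ≤ x ∧ x < 16 * 17 ^ q.1 * q.2.1 + 12 * 17 ^ q.1 ∧
        v.1 = ((x : ℤ), (t : ℤ) - 22 * 17 ^ q.1 - 16 * 17 ^ q.1 * q.2.1 - q.2.2) := by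
    intro q
    by_cases hq : q ∈ S
    · obtain ⟨h1, h2, h3⟩ := hS q hq
      obtain ⟨x, hx1, hx2, v, hv, hv'⟩ := exists_active hK h1 h2 h3
      exact ⟨v, fun _ => ⟨hv, x, hx1, hx2, hv'⟩⟩
    -- An arbitrary value outside `S`.
    · exact ⟨vertex (Nat.zero_le t) (Nat.zero_le t), fun h => absurd h hq⟩
  choose F hF using hex
  refine Finset.card_le_card_of_injOn F (fun q hq => (hF q hq).1) ?_
  rintro ⟨k, a, d⟩ hq ⟨l, b, e⟩ hq' heq
  obtain ⟨-, x, hx1, hx2, hx⟩ := hF _ hq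
  obtain ⟨-, x', hx1', hx2', hx'⟩ := hF _ hq'
  obtain ⟨hk, ha, hd⟩ := hS _ hq
  obtain ⟨hl, hb, he⟩ := hS _ hq'
  rw [heq, hx'] at hx
  obtain ⟨hxx, hyy⟩ := Prod.ext_iff.1 hx
  dsimp only at hx1 hx2 hx1' hx2' hk ha hd hl hb he hxx hyy
  have hxx' : x' = x := by exact_mod_cast hxx
  subst hxx'
  have hsk := hK k hk
  have hsl := hK l hl
  have hyy' : 22 * 17 ^ l + 16 * 17 ^ l * b + e = 22 * 17 ^ k + 16 * 17 ^ k * a + d := by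
    zify
    linarith
  have hak : 4 * (16 * 17 ^ k * a) < t := by
    calc _ = 64 * a * 17 ^ k := by ring
      _ < t := ha
  have hkl : k = l := by
    refine scale_unique (t := t) (w := x' + (t - (22 * 17 ^ k + 16 * 17 ^ k * a + d)))
      (by omega) (by omega) (by omega) (by omega) ?_ ?_ <;> omega
  subst hkl
  have hab : a = b := by
    have hs : 0 < 16 * 17 ^ k := by positivity
    have h1 : x' / (16 * 17 ^ k) = a := Nat.div_eq_of_lt_le (by linarith)
      (by rw [Nat.mul_comm, Nat.mul_add]; omega)
    have h2 : x' / (16 * 17 ^ k) = b := Nat.div_eq_of_lt_le (by linarith)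
      (by rw [Nat.mul_comm, Nat.mul_add]; omega)
    exact h1.symm.trans h2
  subst hab
  obtain rfl : d = e := by omega
  rfl

end Environment

/-! ### Probability of a single environment -/

section Probability

theorem isProbabilityMeasure_passageLaw {p : ℝ} (hp0 : 0 < p) (hp1 : p < 1) :
    IsProbabilityMeasure (passageLaw p) := by
  constructor
  simp [passageLaw]
  rw [← ENNReal.ofReal_add hp0.le (by linarith)]
  simp

theorem le_passageLaw_real_singleton {p : ℝ} (hp0 : 0 < p) (hp1 : p < 1) {c : ℕ}
    (hc : c = 1 ∨ c = 2) : min p (1 - p) ≤ (passageLaw p).real {c} := by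
  rcases hc with rfl | rfl
  · simp [passageLaw, Measure.real, hp0.le]
  · simp [passageLaw, Measure.real, hp1.le]

/-- An edge is determined by its midpoint. -/
theorem card_edgeSet_le (n : ℕ) [Fintype (boxGraph n).edgeSet] :
    Fintype.card (boxGraph n).edgeSet ≤ (4 * n + 1) * (2 * n + 1) := by
  let mid : Sym2 (Box n) → ℤ × ℤ :=
    Sym2.lift ⟨fun u v => u.1 + v.1, fun u v => add_comm _ _⟩
  have hcard : (Finset.Icc (-(2 * n : ℤ)) (2 * n) ×ˢ Finset.Icc (0 : ℤ) (2 * n)).card =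
      (4 * n + 1) * (2 * n + 1) := by
    rw [Finset.card_product, Int.card_Icc, Int.card_Icc]
    congr 1
    all_goals omega
  rw [← hcard, ← Finset.card_univ]
  refine Finset.card_le_card_of_injOn (fun e => mid e.1) ?_ ?_
  · rintro ⟨e, he⟩ -
    induction e using Sym2.ind with
    | _ u v =>
      have hu := Finset.mem_product.1 u.2
      have hv := Finset.mem_product.1 v.2
      rw [Finset.mem_Icc, Finset.mem_Icc] at hu hv
      simp only [mid, Sym2.lift_mk, Finset.coe_product, Set.mem_prod, Finset.coe_Icc, Set.mem_Icc,
        Prod.fst_add, Prod.snd_add]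
      omega
  · rintro ⟨e, he⟩ - ⟨e', he'⟩ - h
    induction e using Sym2.ind with
    | _ u v =>
      induction e' using Sym2.ind with
      | _ u' v' =>
        have h1 : |u.1.1 - v.1.1| + |u.1.2 - v.1.2| = 1 := he
        have h2 : |u'.1.1 - v'.1.1| + |u'.1.2 - v'.1.2| = 1 := he'
        have h3 : u.1 + v.1 = u'.1 + v'.1 := h
        obtain ⟨h3, h4⟩ := Prod.ext_iff.1 h3
        simp only [Prod.fst_add, Prod.snd_add] at h3 h4
        rw [Subtype.mk.injEq, Sym2.eq_iff]
        simp only [Subtype.ext_iff, Prod.ext_iff]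
        rcases abs_cases (u.1.1 - v.1.1) with a1 | a1 <;>
        rcases abs_cases (u.1.2 - v.1.2) with a2 | a2 <;>
        rcases abs_cases (u'.1.1 - v'.1.1) with a3 | a3 <;>
        rcases abs_cases (u'.1.2 - v'.1.2) with a4 | a4 <;> omega

theorem pow_le_environmentLaw_singleton {p : ℝ} (hp0 : 0 < p) (hp1 : p < 1) (n : ℕ)
    (f : (boxGraph n).edgeSet → ℕ) (hf : ∀ e, f e = 1 ∨ f e = 2) :
    min p (1 - p) ^ ((4 * n + 1) * (2 * n + 1)) ≤ (environmentLaw p n).real {f} := by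
  have := isProbabilityMeasure_passageLaw hp0 hp1
  have hpos : 0 < min p (1 - p) := lt_min hp0 (by linarith)
  rw [Measure.real, environmentLaw, Measure.pi_singleton, ENNReal.toReal_prod]
  calc _ ≤ min p (1 - p) ^ Fintype.card (boxGraph n).edgeSet :=
        pow_le_pow_of_le_one hpos.le ((min_le_left _ _).trans hp1.le) (card_edgeSet_le n)
    _ = ∏ _e : (boxGraph n).edgeSet, min p (1 - p) := by simp
    _ ≤ _ := Finset.prod_le_prod (fun _ _ => hpos.le)
        fun e _ => le_passageLaw_real_singleton hp0 hp1 (hf e)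

end Probability

theorem log_le_natLog {t : ℕ} (ht : 17 ^ 4 ≤ t) :
    Real.log t ≤ 6 * ((Nat.log 17 t - 1 : ℕ) : ℝ) := by
  have h4 : 4 ≤ Nat.log 17 t := Nat.le_log_of_pow_le (by norm_num) ht
  have hlt : (t : ℝ) < 17 ^ (Nat.log 17 t + 1) := by
    exact_mod_cast Nat.lt_pow_succ_log_self (by norm_num) t
  have ht0 : (0 : ℝ) < t := by exact_mod_cast (show 0 < t by omega)
  have h := Real.log_le_log ht0 hlt.le
  rw [Real.log_pow] at h
  have h17 : Real.log 17 ≤ 3 := by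
    rw [Real.log_le_iff_le_exp (by norm_num)]
    have h1 : (2.7 : ℝ) ≤ Real.exp 1 := by linarith [Real.exp_one_gt_d9]
    calc (17 : ℝ) ≤ 2.7 ^ 3 := by norm_num
      _ ≤ Real.exp 1 ^ 3 := by gcongr
      _ = Real.exp 3 := by rw [← Real.exp_nat_mul]; norm_num
  have h4' : (4 : ℝ) ≤ Nat.log 17 t := by exact_mod_cast h4
  push_cast [Nat.cast_sub (show 1 ≤ Nat.log 17 t by omega)] at h ⊢
  -- With `L = Nat.log 17 t ≥ 4`, `log t ≤ 3 * (L + 1) ≤ 6 * (L - 1)`.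
  nlinarith

end WaterFlow

theorem mainTheorem2 (p : ℝ) (hp0 : 0 < p) (hp1 : p < 1) :
    ∃ t₀ μ α : ℝ, 0 ≤ t₀ ∧ 0 < μ ∧ 0 < α ∧
      ∀ t : ℕ, t₀ < (t : ℝ) → ∃ n : ℕ, n ≤ t ∧
        Real.exp (-μ * (t : ℝ) ^ 2) ≤
          (WaterFlow.environmentLaw p n).real
            {ω | α * (t : ℝ) * Real.log (t : ℝ) ≤ (WaterFlow.numActive n t ω : ℝ)} := by
  set δ := min p (1 - p) with hδ
  have hδ0 : 0 < δ := lt_min hp0 (by linarith)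
  have hδ1 : δ < 1 := (min_le_left _ _).trans_lt hp1
  have hlogδ : Real.log δ < 0 := Real.log_neg hδ0 hδ1
  -- `15` comes from `(4t + 1)(2t + 1) ≤ 15t²`, and `384 = 64 * 6` from `mul_le_numActive` and
  -- `log_le_natLog`.
  refine ⟨17 ^ 4, 15 * -Real.log δ, 1 / 384, by positivity, by linarith, by norm_num,
    fun t ht => ⟨t, le_rfl, ?_⟩⟩
  have ht' : 17 ^ 4 < t := by exact_mod_cast ht
  -- The largest scale is `17 ^ (Nat.log 17 t - 2)`, so `136 ≤ 17 ^ 2` makes every scale admissible.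
  set K := Nat.log 17 t - 1 with hKdef
  have hK : ∀ l < K, 136 * 17 ^ l ≤ t := by
    intro l hl
    calc 136 * 17 ^ l ≤ 17 ^ 2 * 17 ^ l := by gcongr; norm_num
      _ = 17 ^ (2 + l) := (pow_add ..).symm
      _ ≤ 17 ^ Nat.log 17 t := Nat.pow_le_pow_right (by norm_num) (by omega)
      _ ≤ t := Nat.pow_log_le_self 17 (by omega)
  have := WaterFlow.isProbabilityMeasure_passageLaw hp0 hp1
  have : IsProbabilityMeasure (WaterFlow.environmentLaw p t) := by
    unfold WaterFlow.environmentLaw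
    infer_instance
  have hmem : WaterFlow.environment t K ∈
      {ω | 1 / 384 * (t : ℝ) * Real.log (t : ℝ) ≤ (WaterFlow.numActive t t ω : ℝ)} := by
    have h1 : (K : ℝ) * t ≤ 64 * WaterFlow.numActive t t (WaterFlow.environment t K) := by
      exact_mod_cast WaterFlow.mul_le_numActive hK
    have h2 := WaterFlow.log_le_natLog ht'.le
    have h3 := mul_le_mul_of_nonneg_left h2 (Nat.cast_nonneg (α := ℝ) t)
    change 1 / 384 * (t : ℝ) * Real.log (t : ℝ) ≤ _
    linarith
  have hedges : (((4 * t + 1) * (2 * t + 1) : ℕ) : ℝ) ≤ 15 * (t : ℝ) ^ 2 := by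
    have : (4 * t + 1) * (2 * t + 1) ≤ 15 * t ^ 2 := by nlinarith
    exact_mod_cast this
  calc Real.exp (-(15 * -Real.log δ) * (t : ℝ) ^ 2)
      ≤ Real.exp (((4 * t + 1) * (2 * t + 1) : ℕ) * Real.log δ) := by
        rw [Real.exp_le_exp]
        nlinarith
    _ = δ ^ ((4 * t + 1) * (2 * t + 1)) := by rw [Real.exp_nat_mul, Real.exp_log hδ0]
    _ ≤ (WaterFlow.environmentLaw p t).real {WaterFlow.environment t K} :=
        WaterFlow.pow_le_environmentLaw_singleton hp0 hp1 t _
          (WaterFlow.adaptedTimes_eq_one_or_two _)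
    _ ≤ _ := measureReal_mono (Set.singleton_subset_iff.2 hmem)
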